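/- **Theorem (strong law of large numbers for occupation densities).** Let $d,\nu\ge 1$, write $\Lambda_m=\{-m,\dots,m\}^d\subset\mathbb Z^d$, and let $S\subset\{0,1\}^{\Lambda_\nu}$ be a parking scheme, i.e. any set of local configurations containing the identically zero one. Let $\omega=(\omega(x))_{x\in\mathbb Z^d}$ be distributed on $(0,1)^{\mathbb Z^d}$ according to the product $\mathbb P$ of the uniform (Lebesgue) measures on $(0,1)$. For a finite set $X\subset\mathbb Z^d$, the jamming limit $P_X(\omega)\in\{0,1\}^{\mathbb Z^d}$ is the output of the following algorithm: start from the identically zero configuration $\eta$; visit the sites of $X$ one after another, each exactly once, in increasing order of $\omega$; when $x$ is visited, set $\eta(x)=1$ if $(\eta(x+y))_{y\in\Lambda_\nu}\in S$, and otherwise leave $\eta$ unchanged. (The order is uniquely determined almost surely; ties are broken arbitrarily.) Put $P_n=P_{\Lambda_n}$ and $$\rho_n(\omega)=\frac{1}{(2n+1)^d}\sum_{x\in\Lambda_n}P_n(\omega)(x).$$ For $x\in\mathbb Z^d$ let $\mathcal A(x)(\omega)$ be the set of all $y\in\mathbb Z^d$ for which there are $k\ge 0$ and sites $x=x_0,x_1,\dots,x_k=y$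 with $|x_{i+1}-x_i|_{\sup}\le\nu$ for $0\le i<k$ and $\omega(x_0)>\omega(x_1)>\dots>\omega(x_k)$. The thermodynamic jamming limit $P(\omega)\in\{0,1\}^{\mathbb Z^d}$ is defined by $P(\omega)(x)=P_{\mathcal A(x)(\omega)}(\omega)(x)$ if $\mathcal A(x)(\omega)$ is finite (which is the case almost surely), and $P(\omega)(x)=0$ otherwise. Then $P(0)$, the value of $P$ at the origin, is integrable, and with the constant $\rho=\mathbb E[P(0)]$, $$\rho_n\longrightarrow\rho\quad\text{as } n\to\infty,\qquad \mathbb P\text{-almost surely.}$$ -/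

import Mathlib

open MeasureTheory

namespace Parking

/-- The sites of the lattice `ℤ^d`. -/
abbrev Site (d : ℕ) : Type := Fin d → ℤ

/-- Spin configurations `{0,1}^{ℤ^d}`; `true` is spin 1 (occupied), `false` is spin 0 (vacant). -/
abbrev Config (d : ℕ) : Type := Site d → Bool

/-- The sample space `(0,1)^{ℤ^d}`. -/
abbrev Sample (d : ℕ) : Type := Site d → Set.Ioo (0 : ℝ) 1

/-- Lebesgue (uniform) measure on the open interval `(0,1)`. -/
noncomputable def unifIoo : Measure (Set.Ioo (0 : ℝ) 1) :=
  Measure.comap Subtype.val volume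

instance : IsProbabilityMeasure unifIoo where
  measure_univ := by
    rw [unifIoo, comap_subtype_coe_apply measurableSet_Ioo, Set.image_univ, Subtype.range_coe, Real.volume_Ioo]
    simp

/-- The product measure on `(0,1)^{ℤ^d}` all of whose factors are uniform. -/
noncomputable def sampleMeasure (d : ℕ) : Measure (Sample d) :=
  Measure.infinitePi fun _ : Site d => unifIoo

instance (d : ℕ) : IsProbabilityMeasure (sampleMeasure d) := by
  unfold sampleMeasure; infer_instance

/-- The box `Λ_n = {-n, …, n}^d`. -/
noncomputable def box (d n : ℕ) : Finset (Site d) :=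
  Finset.Icc (fun _ => -(n : ℤ)) (fun _ => (n : ℤ))

/-- A set `S ⊆ {0,1}^{Λ_ν}` of local configurations is a parking scheme if it contains the
identically zero local configuration. -/
def IsParkingScheme {d ν : ℕ} (S : Set (box d ν → Bool)) : Prop :=
  (fun _ => false) ∈ S

/-- The restriction to `Λ_ν` of the translate `θ_x η`, where `θ_x η (y) = η (y + x)`. -/
def localView {d : ℕ} (ν : ℕ) (η : Config d) (x : Site d) : box d ν → Bool :=
  fun y => η ((y : Site d) + x)

open scoped Classical in
/-- A parking attempt at `x`: the site `x` becomes occupied if the configuration seen from `x`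
belongs to the scheme, and nothing changes otherwise. -/
noncomputable def attempt {d ν : ℕ} (S : Set (box d ν → Bool)) (x : Site d) (η : Config d) :
    Config d :=
  if localView ν η x ∈ S then Function.update η x true else η

/-- A site of the nonempty finite set `X` at which `ω` is minimal on `X`. (It is unique unless
`ω` takes equal values at two sites, an event of probability zero.) -/
noncomputable def argmin {d : ℕ} (ω : Sample d) (X : Finset (Site d)) (h : X.Nonempty) : Site d :=
  (X.exists_min_image ω h).choose

theorem argmin_mem {d : ℕ} (ω : Sample d) (X : Finset (Site d)) (h : X.Nonempty) :
    argmin ω X h ∈ X :=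
  (X.exists_min_image ω h).choose_spec.1

open scoped Classical in
/-- The parking algorithm continued from the configuration `η` when `X` is the set of the sites
not chosen yet: choose the remaining site with the smallest value of `ω`, attempt to park there,
and go on until no site remains. -/
noncomputable def runFrom {d ν : ℕ} (S : Set (box d ν → Bool)) (ω : Sample d)
    (X : Finset (Site d)) (η : Config d) : Config d :=
  if h : X.Nonempty then
    runFrom S ω (X.erase (argmin ω X h)) (attempt S (argmin ω X h) η)
  else η
termination_by X.card
decreasing_by exact Finset.card_erase_lt_of_mem (argmin_mem ω X h)

/-- The jamming limit `P_X(ω)` of the parking process on the finite set `X` (null boundary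
condition). -/
noncomputable def jammingLimit {d ν : ℕ} (S : Set (box d ν → Bool)) (X : Finset (Site d))
    (ω : Sample d) : Config d :=
  runFrom S ω X fun _ => false

/-- `(x_i)_{0 ≤ i ≤ n}` is a path of range `ν`: consecutive sites are at sup-distance at most
`ν`. -/
def IsPath {d : ℕ} (ν : ℕ) {n : ℕ} (x : Fin (n + 1) → Site d) : Prop :=
  ∀ i : Fin n, ∀ j : Fin d, |x i.succ j - x i.castSucc j| ≤ (ν : ℤ)

/-- `y` influences `x`: a path of range `ν` along which `ω` is strictly decreasing leads from `x`
to `y`. -/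
def Influences {d : ℕ} (ν : ℕ) (ω : Sample d) (y x : Site d) : Prop :=
  ∃ (n : ℕ) (p : Fin (n + 1) → Site d),
    IsPath ν p ∧ StrictAnti (fun i => ω (p i)) ∧ p 0 = x ∧ p (Fin.last n) = y

/-- The armour of `X`: the set of all sites that influence some site of `X`. -/
def armour {d : ℕ} (ν : ℕ) (X : Set (Site d)) (ω : Sample d) : Set (Site d) :=
  {y | ∃ x ∈ X, Influences ν ω y x}

open scoped Classical in
/-- The thermodynamic jamming limit: `P(ω)(x)` is the value at `x` of the jamming limit of the
parking process on the armour of `{x}`. (The armour is almost surely finite; the value is set to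
`0` where it is infinite.) -/
noncomputable def thermoLimit {d ν : ℕ} (S : Set (box d ν → Bool)) (ω : Sample d) : Config d :=
  fun x =>
    if h : (armour ν {x} ω).Finite then jammingLimit S h.toFinset ω x else false

/-- The spin as a real number, `0` or `1`. -/
noncomputable def spin (b : Bool) : ℝ := if b then 1 else 0

/-- The occupation density `ρ_n(ω) = (∑_{x ∈ Λ_n} P_n(ω)(x)) / |Λ_n|`, where `P_n` is the jamming
limit on `Λ_n`. -/
noncomputable def occupationDensity {d ν : ℕ} (S : Set (box d ν → Bool)) (n : ℕ)
    (ω : Sample d) : ℝ :=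
  (∑ x ∈ box d n, spin (jammingLimit S (box d n) ω x)) / ((box d n).card : ℝ)

end Parking

/-! Whether a site is occupied depends only on the outcomes at the sites within distance `ν` that
have smaller `ω`, hence, recursively, only on the sites reached along `ω`-decreasing paths. If no
decreasing path of `m` steps starts at `x`, all these sites lie in `x + Λ_{mν}`, and every finite
set containing them yields the same spin at `x` (`jammingLimit_shift`). A given path of `m` steps is
decreasing with probability at most `1/(m+1)!`, and there are `|Λ_ν|^m` paths, so long descents are
improbable (`tendsto_measureReal_hasDescent`).

Up to the frequency of long descents and a boundary layer of width `mν`, the density is therefore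
the spatial average of translates of the local function `localSpin S m`
(`abs_occupationDensity_sub_le`). Averages of local functions converge almost surely
(`ae_tendsto_boxAverage`): distant translates are independent, so the variance is `O(1/|Λ_n|)`,
summable along `n = j²`, and monotonicity of the sums fills the gaps. The frequency of descents is
itself such an average and tends to their probability. It remains to let `n → ∞`, then `m → ∞`. -/

namespace Parking

/-! ### The parking algorithm as a recursion along the order of `ω`. -/

variable {d ν : ℕ}

theorem runFrom_of_nonempty (S : Set (box d ν → Bool)) (ω : Sample d) {X : Finset (Site d)}
    (h : X.Nonempty) (η : Config d) :
    runFrom S ω X η = runFrom S ω (X.erase (argmin ω X h)) (attempt S (argmin ω X h) η) := by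
  classical
  rw [runFrom, dif_pos h]

theorem runFrom_empty (S : Set (box d ν → Bool)) (ω : Sample d) (η : Config d) :
    runFrom S ω ∅ η = η := by
  rw [runFrom, dif_neg Finset.not_nonempty_empty]

theorem argmin_le (ω : Sample d) (X : Finset (Site d)) (h : X.Nonempty) {x : Site d}
    (hx : x ∈ X) : ω (argmin ω X h) ≤ ω x :=
  (X.exists_min_image ω h).choose_spec.2 x hx

theorem attempt_of_ne (S : Set (box d ν → Bool)) {x y : Site d} (η : Config d) (h : y ≠ x) :
    attempt S x η y = η y := by
  unfold attempt
  split_ifs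
  · exact Function.update_of_ne h _ _
  · rfl

theorem attempt_self (S : Set (box d ν → Bool)) {x : Site d} {η : Config d} (h : η x = false) :
    attempt S x η x = true ↔ localView ν η x ∈ S := by
  unfold attempt
  split_ifs with h'
  · simp [h']
  · simp [h, h']

theorem runFrom_of_notMem (S : Set (box d ν → Bool)) (ω : Sample d) (X : Finset (Site d))
    (η : Config d) {z : Site d} (hz : z ∉ X) : runFrom S ω X η z = η z := by
  induction X using Finset.strongInduction generalizing η with
  | H X ih =>
    rcases X.eq_empty_or_nonempty with rfl | h
    · rw [runFrom_empty]
    · rw [runFrom_of_nonempty S ω h, ih _ (Finset.erase_ssubset (argmin_mem ω X h)),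
        attempt_of_ne]
      · rintro rfl
        exact hz (argmin_mem ω X h)
      · exact fun h' => hz (Finset.mem_of_mem_erase h')

/-- The outcome at a site visited by the algorithm is decided by the outcome at the sites visited
before. -/
theorem runFrom_eq_true_iff (S : Set (box d ν → Bool)) {ω : Sample d} (hω : Function.Injective ω)
    (X : Finset (Site d)) (η : Config d) (hη : ∀ z ∈ X, η z = false) {x : Site d} (hx : x ∈ X) :
    runFrom S ω X η x = true ↔
      localView ν (fun y => if y ∈ X ∧ ω x ≤ ω y then false else runFrom S ω X η y) x ∈ S := by
  induction X using Finset.strongInduction generalizing η with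
  | H X ih =>
    have h : X.Nonempty := ⟨x, hx⟩
    have ha := argmin_mem ω X h
    have hr := runFrom_of_nonempty S ω h η
    have hle : ∀ y ∈ X, ω (argmin ω X h) ≤ ω y := fun y hy => argmin_le ω X h hy
    generalize argmin ω X h = a at ha hr hle
    by_cases hxa : x = a
    · subst hxa
      -- When `x` comes first, no site of `X` has been visited and the attempt sees `η` itself.
      have hv : (fun y => if y ∈ X ∧ ω x ≤ ω y then false else runFrom S ω X η y) = η := by
        funext y
        by_cases hy : y ∈ X
        · rw [if_pos ⟨hy, hle y hy⟩, hη y hy]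
        · rw [if_neg (fun h' => hy h'.1), runFrom_of_notMem S ω X η hy]
      rw [hv, hr, runFrom_of_notMem S ω _ _ (Finset.notMem_erase x X), attempt_self S (hη x hx)]
    · have hx' : x ∈ X.erase a := Finset.mem_erase.2 ⟨hxa, hx⟩
      have hlt : ω a < ω x := lt_of_le_of_ne (hle x hx) fun h' => hxa (hω h').symm
      rw [hr, ih _ (Finset.erase_ssubset ha) (attempt S a η) _ hx']
      -- Erasing `a` does not change the masked configuration, because `ω a < ω x` already exempts
      -- `a` from the mask.
      · have hv : (fun y => if y ∈ X.erase a ∧ ω x ≤ ω y then false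
              else runFrom S ω (X.erase a) (attempt S a η) y) =
            fun y => if y ∈ X ∧ ω x ≤ ω y then false
              else runFrom S ω (X.erase a) (attempt S a η) y := by
          funext y
          by_cases hya : y = a
          · subst hya
            simp [hlt]
          · simp [hya]
        rw [hv]
      · intro z hz
        rw [attempt_of_ne S η (Finset.ne_of_mem_erase hz)]
        exact hη z (Finset.mem_of_mem_erase hz)

/-- Sites outside `X` stay vacant, so membership in `X` drops out of the mask. The resulting
recursion has the same form for all `X`, which allows different sets to be compared. -/
theorem jammingLimit_eq_true_iff (S : Set (box d ν → Bool)) {ω : Sample d}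
    (hω : Function.Injective ω) (X : Finset (Site d)) {x : Site d} (hx : x ∈ X) :
    jammingLimit S X ω x = true ↔
      localView ν (fun y => if ω y < ω x then jammingLimit S X ω y else false) x ∈ S := by
  unfold jammingLimit
  rw [runFrom_eq_true_iff S hω X _ (fun _ _ => rfl) hx]
  have hv : (fun y => if y ∈ X ∧ ω x ≤ ω y then false
        else runFrom S ω X (fun _ => false) y) =
      fun y => if ω y < ω x then runFrom S ω X (fun _ => false) y else false := by
    funext y
    by_cases hy : y ∈ X
    · by_cases h : ω y < ω x
      · simp [h, not_le.2 h]
      · simp [h, hy, not_lt.1 h]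
    · simp [hy, runFrom_of_notMem S ω X _ hy]
  rw [hv]

/-! ### Dependence on the order of `ω` on `X` only, and measurability. -/

/-- The two defining predicates are equal, so the choice operator returns the same site, even in the
presence of ties. -/
theorem argmin_congr {ω ω' : Sample d} {X : Finset (Site d)} (h : X.Nonempty)
    (hX : ∀ x ∈ X, ∀ y ∈ X, ω x ≤ ω y ↔ ω' x ≤ ω' y) : argmin ω X h = argmin ω' X h := by
  have hp : (fun x => x ∈ X ∧ ∀ y ∈ X, ω x ≤ ω y) = fun x => x ∈ X ∧ ∀ y ∈ X, ω' x ≤ ω' y := by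
    funext x
    exact propext (and_congr_right fun hx => forall₂_congr fun y hy => hX x hx y hy)
  unfold argmin Exists.choose
  congr 1

theorem runFrom_congr (S : Set (box d ν → Bool)) {ω ω' : Sample d} {X : Finset (Site d)}
    (hX : ∀ x ∈ X, ∀ y ∈ X, ω x ≤ ω y ↔ ω' x ≤ ω' y) (η : Config d) :
    runFrom S ω X η = runFrom S ω' X η := by
  induction X using Finset.strongInduction generalizing η with
  | H X ih =>
    rcases X.eq_empty_or_nonempty with rfl | h
    · rw [runFrom_empty, runFrom_empty]
    · rw [runFrom_of_nonempty S ω h, runFrom_of_nonempty S ω' h, argmin_congr h hX]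
      exact ih _ (Finset.erase_ssubset (argmin_mem ω' X h)) (fun x hx y hy =>
        hX x (Finset.mem_of_mem_erase hx) y (Finset.mem_of_mem_erase hy)) _

theorem dependsOn_jammingLimit (S : Set (box d ν → Bool)) (X : Finset (Site d)) :
    DependsOn (jammingLimit S X) (X : Set (Site d)) := fun ω ω' h =>
  runFrom_congr S (fun x hx y hy => by rw [h x hx, h y hy]) _

theorem measurable_jammingLimit_apply (S : Set (box d ν → Bool)) (X : Finset (Site d))
    (x : Site d) : Measurable fun ω : Sample d => jammingLimit S X ω x := by
  -- The table of comparisons on `X` takes finitely many values and determines the jamming limit.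
  let o : Sample d → X × X → Prop := fun ω p => ω p.1 ≤ ω p.2
  have ho : Measurable o := by
    refine measurable_pi_lambda _ fun p => ?_
    exact measurableSet_setOfPred.1
      (measurableSet_le (measurable_pi_apply _) (measurable_pi_apply _))
  have hf : Function.FactorsThrough (fun ω : Sample d => jammingLimit S X ω x) o := by
    intro ω ω' h
    refine congrFun (runFrom_congr S (fun y hy z hz => ?_) _) x
    exact iff_of_eq (congrFun h (⟨y, hy⟩, ⟨z, hz⟩))
  obtain ⟨g, hg⟩ := (Function.factorsThrough_iff _).1 hf
  rw [hg]
  exact (measurable_of_finite g).comp ho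

/-! ### Influence, and locality of the jamming limit. -/

/-- The translate `θ_t ω`, where `θ_t ω (y) = ω (y + t)`. -/
def shift (t : Site d) (ω : Sample d) : Sample d := fun y => ω (y + t)

theorem Influences.refl (ν : ℕ) (ω : Sample d) (x : Site d) : Influences ν ω x x :=
  ⟨0, fun _ => x, fun i => i.elim0, fun i j h => absurd h (by omega),
    rfl, rfl⟩

theorem Influences.cons {ω : Sample d} {w u z : Site d} (h : Influences ν ω w u)
    (hd : ∀ j, |u j - z j| ≤ (ν : ℤ)) (hlt : ω u < ω z) : Influences ν ω w z := by
  obtain ⟨n, p, hp, ha, h0, hn⟩ := h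
  refine ⟨n + 1, Fin.cons z p, ?_, ?_, rfl, ?_⟩
  · intro i
    induction i using Fin.cases with
    | zero => simpa [h0] using hd
    | succ i => simpa [← Fin.succ_castSucc] using hp i
  · rw [Fin.strictAnti_iff_succ_lt]
    intro i
    induction i using Fin.cases with
    | zero => simpa [h0] using hlt
    | succ i => simpa [← Fin.succ_castSucc] using ha i.castSucc_lt_succ
  · rw [← Fin.succ_last, Fin.cons_succ, hn]

theorem mem_box_iff {n : ℕ} {x : Site d} : x ∈ box d n ↔ ∀ j, |x j| ≤ (n : ℤ) := by
  simp only [box, Finset.mem_Icc, Pi.le_def, abs_le, forall_and]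

/-- The jamming limit at a site is determined, up to translations, by the sites that influence
it. -/
theorem jammingLimit_shift (S : Set (box d ν → Bool)) {ω : Sample d} (hω : Function.Injective ω)
    (t : Site d) (X Y : Finset (Site d)) {z : Site d}
    (hz : ∀ w, Influences ν (shift t ω) w z → w ∈ X ∧ w + t ∈ Y) :
    jammingLimit S X (shift t ω) z = jammingLimit S Y ω (z + t) := by
  have hω' : Function.Injective (shift t ω) := fun x y h => add_right_cancel (hω h)
  -- Induction on the rank of `z` in `X`: a neighbour that matters has a smaller value, hence a
  -- smaller rank.
  induction hk : (X.filter fun w => shift t ω w < shift t ω z).card using Nat.strong_induction_on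
    generalizing z with
  | _ k ih =>
    obtain ⟨hzX, hzY⟩ := hz z (Influences.refl ν _ z)
    rw [Bool.eq_iff_iff, jammingLimit_eq_true_iff S hω' X hzX, jammingLimit_eq_true_iff S hω Y hzY]
    refine iff_of_eq (congrArg (· ∈ S) (funext fun y => ?_))
    simp only [localView, ← add_assoc]
    refine if_ctx_congr Iff.rfl (fun hlt => ?_) fun _ => rfl
    -- Whatever influences a lower neighbour of `z` influences `z`, so the hypothesis on `X` and `Y`
    -- is inherited.
    have hu : ∀ w, Influences ν (shift t ω) w (y + z) → Influences ν (shift t ω) w z :=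
      fun w hw => hw.cons (by simpa using mem_box_iff.1 y.2) hlt
    refine ih _ ?_ (fun w hw => hz w (hu w hw)) rfl
    rw [← hk]
    refine Finset.card_lt_card (Finset.ssubset_iff_of_subset ?_ |>.2 ⟨y + z, ?_, by simp⟩)
    · exact Finset.monotone_filter_right X fun w _ hw => lt_trans hw hlt
    · exact Finset.mem_filter.2 ⟨(hz _ (hu _ (Influences.refl ν _ _))).1, hlt⟩

/-! ### Descents: range, measurability, and localisation of the spins. -/

theorem IsPath.abs_sub_le {n : ℕ} {p : Fin (n + 1) → Site d} (hp : IsPath ν p) (i : Fin (n + 1))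
    (j : Fin d) : |p i j - p 0 j| ≤ (i : ℤ) * ν := by
  induction i using Fin.induction with
  | zero => simp
  | succ i ih =>
    have h1 := hp i j
    have h2 := _root_.abs_sub_le (p i.succ j) (p i.castSucc j) (p 0 j)
    simp only [Fin.val_castSucc, Fin.val_succ] at ih ⊢
    push_cast
    linarith

/-- There is a path of range `ν` with `m` steps that starts at the origin and along which `ω` is
strictly decreasing. -/
def HasDescent (ν m : ℕ) (ω : Sample d) : Prop :=
  ∃ p : Fin (m + 1) → Site d, IsPath ν p ∧ p 0 = 0 ∧ StrictAnti fun i => ω (p i)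

/-- A decreasing path with at least `m` steps could be truncated to a descent of exactly `m` steps;
a shorter one travels at most `m * ν`. -/
theorem Influences.mem_box {m : ℕ} {ω : Sample d} {y : Site d} (h : Influences ν ω y 0)
    (hm : ¬ HasDescent ν m ω) : y ∈ box d (m * ν) := by
  obtain ⟨n, p, hp, ha, h0, rfl⟩ := h
  have hnm : n < m := by
    by_contra! hmn
    refine hm ⟨fun i => p (Fin.castLE (by omega) i), fun i j => ?_, ?_, fun i j hij => ?_⟩
    · exact hp (Fin.castLE hmn i) j
    · exact h0
    · exact ha (show Fin.castLE _ i < Fin.castLE _ j from hij)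
  rw [mem_box_iff]
  intro j
  have h1 := hp.abs_sub_le (Fin.last n) j
  rw [h0] at h1
  simp only [Pi.zero_apply, sub_zero, Fin.val_last] at h1
  refine h1.trans ?_
  push_cast
  gcongr

theorem IsPath.mem_box {m : ℕ} {p : Fin (m + 1) → Site d} (hp : IsPath ν p) (h0 : p 0 = 0)
    (i : Fin (m + 1)) : p i ∈ box d (m * ν) := by
  rw [mem_box_iff]
  intro j
  have h1 := hp.abs_sub_le i j
  rw [h0] at h1
  simp only [Pi.zero_apply, sub_zero] at h1
  refine h1.trans ?_
  push_cast
  gcongr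
  exact_mod_cast Nat.lt_succ_iff.1 i.2

theorem dependsOn_hasDescent (ν m : ℕ) :
    DependsOn (HasDescent (d := d) ν m) (box d (m * ν) : Set (Site d)) := by
  intro ω ω' h
  refine propext (exists_congr fun p => and_congr_right fun hp => and_congr_right fun h0 => ?_)
  rw [show (fun i => ω (p i)) = fun i => ω' (p i) from funext fun i => h _ (hp.mem_box h0 i)]

theorem measurableSet_strictAnti {n : ℕ} (p : Fin n → Site d) :
    MeasurableSet {ω : Sample d | StrictAnti fun i => ω (p i)} := by
  simp only [StrictAnti, Set.ofPred_forall]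
  exact .iInter fun i => .iInter fun j => .iInter fun _ =>
    measurableSet_lt (measurable_pi_apply _) (measurable_pi_apply _)

theorem measurableSet_hasDescent (ν m : ℕ) :
    MeasurableSet {ω : Sample d | HasDescent ν m ω} := by
  simp only [HasDescent, Set.ofPred_exists, Set.ofPred_and]
  exact .iUnion fun p => (MeasurableSet.const _).inter
    ((MeasurableSet.const _).inter (measurableSet_strictAnti p))

theorem measurableSet_influences (ν : ℕ) (y x : Site d) :
    MeasurableSet {ω : Sample d | Influences ν ω y x} := by
  simp only [Influences, Set.ofPred_exists, Set.ofPred_and]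
  exact .iUnion fun n => .iUnion fun p => (MeasurableSet.const _).inter
    ((measurableSet_strictAnti p).inter ((MeasurableSet.const _).inter (MeasurableSet.const _)))

theorem mem_armour_singleton {ω : Sample d} {x y : Site d} :
    y ∈ armour ν {x} ω ↔ Influences ν ω y x := by
  simp [armour]

theorem measurable_thermoLimit_apply (S : Set (box d ν → Bool)) (x : Site d) :
    Measurable fun ω : Sample d => thermoLimit S ω x := by
  refine measurable_to_bool ?_
  -- Split according to the value `A` of the armour: only countably many finite sets are possible.
  have h : (fun ω : Sample d => thermoLimit S ω x) ⁻¹' {true} =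
      ⋃ A : Finset (Site d), {ω | ∀ y, y ∈ A ↔ Influences ν ω y x} ∩
        {ω | jammingLimit S A ω x = true} := by
    ext ω
    simp only [Set.mem_preimage, Set.mem_singleton_iff, Set.mem_iUnion, Set.mem_inter_iff,
      Set.mem_ofPred_eq, thermoLimit]
    constructor
    · intro h
      split_ifs at h with hf
      exact ⟨hf.toFinset, fun y => by rw [Set.Finite.mem_toFinset, mem_armour_singleton], h⟩
    · rintro ⟨A, hA, h⟩
      have hA' : armour ν {x} ω = A := by
        ext y
        rw [mem_armour_singleton, Finset.mem_coe, hA]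
      simpa [hA'] using h
  rw [h]
  refine .iUnion fun A => .inter ?_
    (measurable_jammingLimit_apply S A x (measurableSet_singleton true))
  simp only [Set.ofPred_forall]
  refine .iInter fun y => ?_
  by_cases hy : y ∈ A
  · simpa [hy] using measurableSet_influences ν y x
  · simp only [hy, false_iff]
    exact (measurableSet_influences ν y x).compl

theorem thermoLimit_zero_eq (S : Set (box d ν → Bool)) {ω : Sample d}
    (hω : Function.Injective ω) {m : ℕ} (hm : ¬ HasDescent ν m ω) :
    thermoLimit S ω 0 = jammingLimit S (box d (m * ν)) ω 0 := by
  have hf : (armour ν {0} ω).Finite := (box d (m * ν)).finite_toSet.subset fun y hy =>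
    (mem_armour_singleton.1 hy).mem_box hm
  have hs : shift 0 ω = ω := by funext y; simp [shift]
  have h := jammingLimit_shift S hω 0 hf.toFinset (box d (m * ν)) (z := 0)
  simp only [hs, add_zero] at h
  rw [thermoLimit, dif_pos hf]
  exact h fun w hw => ⟨by simpa [mem_armour_singleton] using hw, hw.mem_box hm⟩

/-- The margin `m * ν` makes the larger box contain `x + Λ_{mν}`, where all sites influencing `x`
lie. -/
theorem jammingLimit_box_eq (S : Set (box d ν → Bool)) {ω : Sample d}
    (hω : Function.Injective ω) {m n : ℕ} {x : Site d} (hx : x ∈ box d n)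
    (hm : ¬ HasDescent ν m (shift x ω)) :
    jammingLimit S (box d (n + m * ν)) ω x = jammingLimit S (box d (m * ν)) (shift x ω) 0 := by
  have h := jammingLimit_shift S hω x (box d (m * ν)) (box d (n + m * ν)) (z := 0)
  rw [zero_add] at h
  refine (h fun w hw => ⟨hw.mem_box hm, mem_box_iff.2 fun j => ?_⟩).symm
  have h1 := mem_box_iff.1 (hw.mem_box hm) j
  have h2 := mem_box_iff.1 hx j
  have h3 := abs_add_le (w j) (x j)
  simp only [Pi.add_apply]
  push_cast at h1 ⊢
  linarith

/-! ### Symmetries of the product measure and the probability of a descent. -/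

theorem measurePreserving_comp_perm (e : Equiv.Perm (Site d)) :
    MeasurePreserving (fun ω : Sample d => ω ∘ e) (sampleMeasure d) (sampleMeasure d) := by
  have hm : Measurable fun ω : Sample d => ω ∘ e :=
    measurable_pi_lambda _ fun i => measurable_pi_apply (e i)
  refine ⟨hm, ?_⟩
  refine Measure.eq_infinitePi _ fun s t ht => ?_
  have hs : (fun ω : Sample d => ω ∘ e) ⁻¹' Set.pi s t =
      Set.pi (s.map e.toEmbedding : Finset (Site d)) (fun i => t (e.symm i)) := by
    ext ω
    simp only [Set.mem_preimage, Set.mem_pi, Finset.mem_coe, Function.comp_apply,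
      Finset.mem_map_equiv]
    exact ⟨fun h i hi => by simpa using h _ hi,
      fun h i hi => by simpa using h (e i) (by simpa using hi)⟩
  rw [Measure.map_apply hm (.pi s.countable_toSet fun i _ => ht i), hs, sampleMeasure,
    Measure.infinitePi_pi _ fun i _ => ht _]
  simp

theorem measurePreserving_shift (t : Site d) :
    MeasurePreserving (shift t) (sampleMeasure d) (sampleMeasure d) :=
  measurePreserving_comp_perm (Equiv.addRight t)

instance : NullSingletonClass unifIoo where
  measure_singleton a := by
    rw [unifIoo, comap_subtype_coe_apply measurableSet_Ioo, Set.image_singleton]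
    simp

theorem iIndepFun_eval :
    ProbabilityTheory.iIndepFun (fun (x : Site d) (ω : Sample d) => ω x) (sampleMeasure d) :=
  ProbabilityTheory.iIndepFun_infinitePi (X := fun _ u => u) fun _ => measurable_id

theorem map_eval (x : Site d) :
    (sampleMeasure d).map (fun ω => ω x) = unifIoo :=
  (measurePreserving_eval_infinitePi _ x).map_eq

/-- Two coordinates are independent with an atomless law, so by Fubini the diagonal is null. -/
theorem ae_ne {x y : Site d} (h : x ≠ y) : ∀ᵐ ω ∂sampleMeasure d, ω x ≠ ω y := by
  have hxy := iIndepFun_eval.indepFun h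
  rw [ProbabilityTheory.indepFun_iff_map_prod_eq_prod_map_map
    (measurable_pi_apply x).aemeasurable (measurable_pi_apply y).aemeasurable,
    map_eval, map_eval] at hxy
  have hm : Measurable fun ω : Sample d => (ω x, ω y) :=
    (measurable_pi_apply x).prodMk (measurable_pi_apply y)
  have hD : MeasurableSet {p : Set.Ioo (0 : ℝ) 1 × Set.Ioo (0 : ℝ) 1 | p.1 = p.2} :=
    measurableSet_eq_fun measurable_fst measurable_snd
  have h0 : (unifIoo.prod unifIoo) {p | p.1 = p.2} = 0 := by
    rw [Measure.measure_prod_null hD]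
    refine .of_forall fun a => ?_
    have : Prod.mk a ⁻¹' {p : Set.Ioo (0 : ℝ) 1 × Set.Ioo (0 : ℝ) 1 | p.1 = p.2} = {a} := by
      ext b
      simp [eq_comm]
    simp [this]
  rw [← hxy, Measure.map_apply hm hD] at h0
  rw [ae_iff]
  simpa using h0

theorem ae_injective : ∀ᵐ ω ∂sampleMeasure d, Function.Injective ω := by
  have h : ∀ᵐ ω ∂sampleMeasure d, ∀ x y : Site d, x ≠ y → ω x ≠ ω y :=
    ae_all_iff.2 fun x => ae_all_iff.2 fun y => by
      by_cases hxy : x = y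
      · exact .of_forall fun ω h => absurd hxy h
      · filter_upwards [ae_ne hxy] with ω h _ using h
  filter_upwards [h] with ω h x y
  exact not_imp_not.1 (h x y)

/-- All orderings of finitely many sites are equally likely. -/
theorem measure_strictAnti_le {n : ℕ} (p : Fin n → Site d) :
    sampleMeasure d {ω | StrictAnti fun i => ω (p i)} ≤ (n.factorial : ENNReal)⁻¹ := by
  by_cases hp : Function.Injective p
  swap
  · have : {ω : Sample d | StrictAnti fun i => ω (p i)} = ∅ := by
      refine Set.eq_empty_of_forall_notMem fun ω h => hp fun i j hij => ?_
      exact StrictAnti.injective h (congrArg ω hij)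
    simp [this]
  -- The `n!` events `E σ` are disjoint and equally likely, so each has probability at most `1/n!`.
  let E : Equiv.Perm (Fin n) → Set (Sample d) := fun σ => {ω | StrictAnti fun i => ω (p (σ i))}
  have hE : ∀ σ, MeasurableSet (E σ) := fun σ => measurableSet_strictAnti fun i => p (σ i)
  have hμ : ∀ σ, sampleMeasure d (E σ) = sampleMeasure d {ω | StrictAnti fun i => ω (p i)} := by
    intro σ
    -- Extended by the identity off the range of `p`, `σ` permutes the whole lattice.
    rw [← (measurePreserving_comp_perm (σ.viaEmbedding ⟨p, hp⟩)).measure_preimage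
      (measurableSet_strictAnti p).nullMeasurableSet]
    congr 1
    ext ω
    have : ∀ i, (σ.viaEmbedding ⟨p, hp⟩) (p i) = p (σ i) :=
      fun i => σ.viaEmbedding_apply ⟨p, hp⟩ i
    simp [E, this]
  have hd : Pairwise (Function.onFun Disjoint E) := by
    intro σ τ hστ
    refine Set.disjoint_left.2 fun ω h1 h2 => hστ ?_
    have hr : ∀ ρ : Equiv.Perm (Fin n), Set.range (fun i => ω (p (ρ i))) =
        Set.range fun i => ω (p i) := fun ρ => ρ.surjective.range_comp fun i => ω (p i)
    -- A set has at most one strictly decreasing enumeration by `Fin n`.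
    have h := (StrictAnti.range_inj h1 h2).1 ((hr σ).trans (hr τ).symm)
    refine Equiv.ext fun i => (Equiv.symm_apply_eq τ).1 ?_
    apply StrictAnti.injective h2
    simpa using congrFun h i
  have hsum : ∑ σ, sampleMeasure d (E σ) ≤ 1 := by
    rw [← measure_biUnion_finset (fun σ _ τ _ h => hd h) fun σ _ => hE σ]
    exact prob_le_one
  simp only [hμ, Finset.sum_const, Finset.card_univ, Fintype.card_perm, Fintype.card_fin,
    nsmul_eq_mul] at hsum
  rw [ENNReal.le_inv_iff_mul_le, mul_comm]
  exact hsum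

/-- Union bound: a path from the origin is coded by its `m` increments in `Λ_ν`, and it visits `m +
1` sites. -/
theorem measure_hasDescent_le (ν m : ℕ) :
    sampleMeasure d {ω | HasDescent ν m ω} ≤
      ((box d ν).card : ENNReal) ^ m * ((m + 1).factorial : ENNReal)⁻¹ := by
  let P : (Fin m → box d ν) → Fin (m + 1) → Site d :=
    fun s => Fin.partialSum fun i => (s i : Site d)
  have hsub : {ω : Sample d | HasDescent ν m ω} ⊆ ⋃ s, {ω | StrictAnti fun i => ω (P s i)} := by
    rintro ω ⟨p, hp, h0, ha⟩
    refine Set.mem_iUnion.2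
      ⟨fun i => ⟨p i.succ - p i.castSucc, mem_box_iff.2 fun j => hp i j⟩, ?_⟩
    have hP : P (fun i => ⟨p i.succ - p i.castSucc, mem_box_iff.2 fun j => hp i j⟩) = p := by
      funext i
      induction i using Fin.induction with
      | zero => simp [P, h0]
      | succ i ih =>
        simp only [P] at ih ⊢
        rw [Fin.partialSum_succ, ih]
        abel
    rw [hP]
    exact ha
  calc sampleMeasure d {ω | HasDescent ν m ω}
      ≤ ∑ s, sampleMeasure d {ω | StrictAnti fun i => ω (P s i)} :=
        (measure_mono hsub).trans (measure_iUnion_fintype_le _ _)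
    _ ≤ ∑ _s : Fin m → box d ν, ((m + 1).factorial : ENNReal)⁻¹ :=
        Finset.sum_le_sum fun s _ => measure_strictAnti_le (P s)
    _ = _ := by simp

theorem tendsto_measureReal_hasDescent (d ν : ℕ) :
    Filter.Tendsto (fun m => (sampleMeasure d).real {ω | HasDescent ν m ω}) Filter.atTop
      (nhds 0) := by
  refine squeeze_zero (fun m => measureReal_nonneg) (fun m => ?_)
    (FloorSemiring.tendsto_pow_div_factorial_atTop ((box d ν).card : ℝ))
  have h := ENNReal.toReal_mono (by finiteness) (measure_hasDescent_le (d := d) ν m)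
  refine h.trans ?_
  simp only [ENNReal.toReal_mul, ENNReal.toReal_pow, ENNReal.toReal_natCast, ENNReal.toReal_inv]
  rw [div_eq_mul_inv]
  gcongr
  exact Nat.le_succ m

/-! ### Law of large numbers for box averages of local functions. -/

theorem card_box (d n : ℕ) : (box d n).card = (2 * n + 1) ^ d := by
  rw [box, Pi.card_Icc]
  simp only [Int.card_Icc, Finset.prod_const, Finset.card_univ, Fintype.card_fin]
  congr 1
  omega

theorem box_mono (d : ℕ) {m n : ℕ} (h : m ≤ n) : box d m ⊆ box d n := fun x hx =>
  mem_box_iff.2 fun j => (mem_box_iff.1 hx j).trans (by exact_mod_cast h)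

/-- The spatial average over the box `Λ_n` of the translates of `f`. -/
noncomputable def boxAverage (f : Sample d → ℝ) (n : ℕ) (ω : Sample d) : ℝ :=
  (∑ x ∈ box d n, f (shift x ω)) / ((box d n).card : ℝ)

theorem card_box_pos (d n : ℕ) : (0 : ℝ) < (box d n).card := by
  rw [card_box]
  positivity

theorem measurable_shift (t : Site d) : Measurable (shift t) :=
  (measurePreserving_shift t).measurable

/-- The two translates read the coordinates in `x + Λ_r` and `y + Λ_r`, which are disjoint. -/
theorem indepFun_shift {f : Sample d → ℝ} (hf : Measurable f) {r : ℕ}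
    (hr : DependsOn f (box d r : Set (Site d))) {x y : Site d} (hxy : y - x ∉ box d (2 * r)) :
    ProbabilityTheory.IndepFun (fun ω => f (shift x ω)) (fun ω => f (shift y ω))
      (sampleMeasure d) := by
  classical
  let T : Site d → Finset (Site d) := fun t => (box d r).map (Equiv.addRight t).toEmbedding
  have hT : Disjoint (T x) (T y) := by
    refine Finset.disjoint_left.2 fun u hu hv => hxy ?_
    simp only [T, Finset.mem_map_equiv, Equiv.addRight_symm, Equiv.coe_addRight, mem_box_iff,
      Pi.add_apply, Pi.neg_apply, Pi.sub_apply] at hu hv ⊢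
    intro j
    have h1 := hu j
    have h2 := hv j
    rw [abs_le] at h1 h2 ⊢
    push_cast
    constructor <;> linarith
  have hind := iIndepFun_eval.indepFun_finset (T x) (T y) hT fun i => measurable_pi_apply i
  -- An arbitrary filler for the coordinates outside the window, which `f` ignores.
  let c : Set.Ioo (0 : ℝ) 1 := ⟨1 / 2, by norm_num, by norm_num⟩
  let ext : (t : Site d) → (T t → Set.Ioo (0 : ℝ) 1) → Sample d := fun t v z =>
    if h : z + t ∈ T t then v ⟨z + t, h⟩ else c
  have hext : ∀ t, Measurable (ext t) := fun t => by
    refine measurable_pi_lambda _ fun z => ?_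
    by_cases h : z + t ∈ T t
    · simpa only [ext, h, dif_pos] using measurable_pi_apply _
    · simpa only [ext, h, dif_neg, not_false_eq_true] using measurable_const
  have hfac : ∀ t, (fun ω => f (shift t ω)) =
      (fun v => f (ext t v)) ∘ fun (ω : Sample d) (i : T t) => ω i := by
    intro t
    funext ω
    refine hr fun z hz => ?_
    have : z + t ∈ T t := Finset.mem_map.2 ⟨z, hz, rfl⟩
    simp [ext, this, shift]
  rw [hfac x, hfac y]
  exact hind.comp (hf.comp (hext x)) (hf.comp (hext y))

section LocalFunction

variable {f : Sample d → ℝ} {r : ℕ}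

theorem integrable_shift (hf : Measurable f) (h0 : ∀ ω, 0 ≤ f ω) (h1 : ∀ ω, f ω ≤ 1)
    (t : Site d) : Integrable (fun ω => f (shift t ω)) (sampleMeasure d) :=
  .of_bound (hf.comp (measurable_shift t)).aestronglyMeasurable 1
    (.of_forall fun ω => by rw [Real.norm_of_nonneg (h0 _)]; exact h1 _)

theorem integral_shift (hf : Measurable f) (t : Site d) :
    ∫ ω, f (shift t ω) ∂sampleMeasure d = ∫ ω, f ω ∂sampleMeasure d := by
  have h := integral_map (μ := sampleMeasure d) (measurable_shift t).aemeasurable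
    (f := f) hf.aestronglyMeasurable
  rw [(measurePreserving_shift t).map_eq] at h
  exact h.symm

theorem integral_mem_Icc (h0 : ∀ ω, 0 ≤ f ω) (h1 : ∀ ω, f ω ≤ 1) :
    ∫ ω, f ω ∂sampleMeasure d ∈ Set.Icc (0 : ℝ) 1 := by
  refine ⟨integral_nonneg h0, ?_⟩
  have h := norm_integral_le_of_norm_le_const (μ := sampleMeasure d) (f := f) (C := 1)
    (.of_forall fun ω => by rw [Real.norm_of_nonneg (h0 _)]; exact h1 _)
  simpa using (le_abs_self _).trans h

/-- The covariances of a local function vanish at large distances. -/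
theorem integral_covariance_eq_zero (hf : Measurable f)
    (hr : DependsOn f (box d r : Set (Site d))) (h0 : ∀ ω, 0 ≤ f ω) (h1 : ∀ ω, f ω ≤ 1)
    {x y : Site d} (hxy : y - x ∉ box d (2 * r)) :
    ∫ ω, (f (shift x ω) - ∫ ω', f ω' ∂sampleMeasure d) *
      (f (shift y ω) - ∫ ω', f ω' ∂sampleMeasure d) ∂sampleMeasure d = 0 := by
  set a := ∫ ω', f ω' ∂sampleMeasure d with ha
  have hind := (indepFun_shift hf hr hxy).comp (measurable_id.sub_const a)
    (measurable_id.sub_const a)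
  have hm : ∀ t, AEStronglyMeasurable ((fun u : ℝ => id u - a) ∘ fun ω => f (shift t ω))
      (sampleMeasure d) := fun t =>
    ((measurable_id.sub_const a).comp (hf.comp (measurable_shift t))).aestronglyMeasurable
  have h := hind.integral_mul_eq_mul_integral (hm x) (hm y)
  have hz : ∫ ω, (f (shift x ω) - a) ∂sampleMeasure d = 0 := by
    rw [integral_sub (integrable_shift hf h0 h1 x) (integrable_const a), integral_shift hf]
    simp [ha]
  refine h.trans ?_
  simp only [Function.comp_def, id]
  rw [hz, zero_mul]

theorem boxAverage_sub (f : Sample d → ℝ) (a : ℝ) (n : ℕ) (ω : Sample d) :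
    boxAverage f n ω - a = (∑ x ∈ box d n, (f (shift x ω) - a)) / ((box d n).card : ℝ) := by
  have := (card_box_pos d n).ne'
  rw [boxAverage, Finset.sum_sub_distrib, Finset.sum_const, nsmul_eq_mul]
  field_simp

theorem abs_sub_integral_le (h0 : ∀ ω, 0 ≤ f ω) (h1 : ∀ ω, f ω ≤ 1) (ω : Sample d) :
    |f ω - ∫ ω', f ω' ∂sampleMeasure d| ≤ 1 := by
  obtain ⟨ha0, ha1⟩ := integral_mem_Icc h0 h1
  rw [abs_le]
  constructor <;> linarith [h0 ω, h1 ω]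

theorem integrable_covariance (hf : Measurable f) (h0 : ∀ ω, 0 ≤ f ω) (h1 : ∀ ω, f ω ≤ 1)
    (x y : Site d) :
    Integrable (fun ω => (f (shift x ω) - ∫ ω', f ω' ∂sampleMeasure d) *
      (f (shift y ω) - ∫ ω', f ω' ∂sampleMeasure d)) (sampleMeasure d) := by
  refine .of_bound (((hf.comp (measurable_shift x)).sub_const _).mul
    ((hf.comp (measurable_shift y)).sub_const _)).aestronglyMeasurable 1 (.of_forall fun ω => ?_)
  rw [Real.norm_eq_abs, abs_mul]
  exact mul_le_one₀ (abs_sub_integral_le h0 h1 _) (abs_nonneg _) (abs_sub_integral_le h0 h1 _)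

/-- In the expanded square, each `x` has at most `|Λ_{2r}|` partners `y` with nonzero covariance,
and covariances are at most 1. The double sum is thus at most `|Λ_n| |Λ_{2r}|`, to be divided by
`|Λ_n|²`. -/
theorem integral_boxAverage_sub_sq_le (hf : Measurable f)
    (hr : DependsOn f (box d r : Set (Site d))) (h0 : ∀ ω, 0 ≤ f ω) (h1 : ∀ ω, f ω ≤ 1) (n : ℕ) :
    ∫ ω, (boxAverage f n ω - ∫ ω', f ω' ∂sampleMeasure d) ^ 2 ∂sampleMeasure d ≤
      ((box d (2 * r)).card : ℝ) / (box d n).card := by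
  classical
  set a := ∫ ω', f ω' ∂sampleMeasure d with ha
  have hint := integrable_covariance hf h0 h1
  rw [← ha] at hint
  have hcov : ∀ x y : Site d, ∫ ω, (f (shift x ω) - a) * (f (shift y ω) - a) ∂sampleMeasure d ≤
      if y - x ∈ box d (2 * r) then 1 else 0 := by
    intro x y
    split_ifs with hxy
    · have h := norm_integral_le_of_norm_le_const (μ := sampleMeasure d)
        (f := fun ω => (f (shift x ω) - a) * (f (shift y ω) - a)) (C := 1)
        (.of_forall fun ω => by
          rw [Real.norm_eq_abs, abs_mul]
          exact mul_le_one₀ (abs_sub_integral_le h0 h1 _) (abs_nonneg _)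
            (abs_sub_integral_le h0 h1 _))
      simpa using (le_abs_self _).trans h
    · exact (integral_covariance_eq_zero hf hr h0 h1 hxy).le
  have hrow : ∀ x : Site d, (∑ y ∈ box d n, if y - x ∈ box d (2 * r) then (1 : ℝ) else 0) ≤
      (box d (2 * r)).card := by
    intro x
    rw [Finset.sum_boole]
    exact_mod_cast Finset.card_le_card_of_injOn (fun y => y - x)
      (fun y hy => (Finset.mem_filter.1 hy).2) fun y _ z _ h => sub_left_injective h
  have hsq : ∀ ω, (boxAverage f n ω - a) ^ 2 =
      (∑ x ∈ box d n, ∑ y ∈ box d n, (f (shift x ω) - a) * (f (shift y ω) - a)) /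
        ((box d n).card : ℝ) ^ 2 := by
    intro ω
    rw [boxAverage_sub, div_pow, sq (∑ x ∈ box d n, _), Finset.sum_mul_sum]
  simp only [hsq]
  rw [integral_div, integral_finsetSum _ fun x _ => integrable_finsetSum _ fun y _ => hint x y]
  have hsum : ∑ x ∈ box d n, ∫ ω, ∑ y ∈ box d n, (f (shift x ω) - a) * (f (shift y ω) - a)
      ∂sampleMeasure d ≤ ∑ x ∈ box d n, ((box d (2 * r)).card : ℝ) := by
    refine Finset.sum_le_sum fun x _ => ?_
    rw [integral_finsetSum _ fun y _ => hint x y]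
    exact (Finset.sum_le_sum fun y _ => hcov x y).trans (hrow x)
  rw [Finset.sum_const, nsmul_eq_mul] at hsum
  have hc := card_box_pos d n
  rw [div_le_div_iff₀ (by positivity) hc]
  nlinarith

theorem measurable_boxAverage (hf : Measurable f) (n : ℕ) : Measurable (boxAverage f n) :=
  (Finset.measurable_sum _ fun x _ => hf.comp (measurable_shift x)).div_const _

theorem boxAverage_mem_Icc (h0 : ∀ ω, 0 ≤ f ω) (h1 : ∀ ω, f ω ≤ 1) (n : ℕ) (ω : Sample d) :
    boxAverage f n ω ∈ Set.Icc (0 : ℝ) 1 := by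
  refine ⟨div_nonneg (Finset.sum_nonneg fun x _ => h0 _) (by positivity), ?_⟩
  rw [boxAverage, div_le_one (card_box_pos d n)]
  refine (Finset.sum_le_sum fun x _ => h1 (shift x ω)).trans ?_
  simp

/-- Along squares the variances are `O(1/j²)`, so the squared deviations have a finite expected sum.
Almost surely their sum is finite and its terms tend to zero. -/
theorem ae_tendsto_boxAverage_sq (hd : 1 ≤ d) (hf : Measurable f)
    (hr : DependsOn f (box d r : Set (Site d))) (h0 : ∀ ω, 0 ≤ f ω) (h1 : ∀ ω, f ω ≤ 1) :
    ∀ᵐ ω ∂sampleMeasure d, Filter.Tendsto (fun j : ℕ => boxAverage f (j ^ 2) ω) Filter.atTop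
      (nhds (∫ ω', f ω' ∂sampleMeasure d)) := by
  set a := ∫ ω', f ω' ∂sampleMeasure d with ha
  let Z : ℕ → Sample d → ℝ := fun j ω => (boxAverage f (j ^ 2) ω - a) ^ 2
  have hZm : ∀ j, Measurable (Z j) := fun j =>
    ((measurable_boxAverage hf _).sub_const a).pow_const 2
  have hZ0 : ∀ j ω, 0 ≤ Z j ω := fun j ω => sq_nonneg _
  have ha' := integral_mem_Icc h0 h1
  have hZi : ∀ j, Integrable (Z j) (sampleMeasure d) := fun j =>
    .of_bound (hZm j).aestronglyMeasurable 1 (.of_forall fun ω => by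
      obtain ⟨h2, h3⟩ := boxAverage_mem_Icc h0 h1 (j ^ 2) ω
      rw [Real.norm_of_nonneg (hZ0 j ω)]
      refine (sq_le_one_iff_abs_le_one _).2 (abs_le.2 ?_)
      constructor <;> linarith [ha'.1, ha'.2])
  have hsum : Summable fun j => ∫ ω, Z j ω ∂sampleMeasure d := by
    refine Summable.of_norm_bounded_eventually_nat (g := fun j : ℕ =>
      ((box d (2 * r)).card : ℝ) * (1 / (j : ℝ) ^ 2))
      ((Real.summable_one_div_nat_pow.2 one_lt_two).mul_left _) ?_
    filter_upwards [Filter.eventually_gt_atTop 0] with j hj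
    rw [Real.norm_of_nonneg (integral_nonneg (hZ0 j))]
    refine (integral_boxAverage_sub_sq_le hf hr h0 h1 (j ^ 2)).trans ?_
    rw [← div_eq_mul_one_div]
    gcongr
    rw [card_box]
    -- This is where `d ≥ 1` enters: for `d = 0` the box would not grow.
    have : j ^ 2 ≤ (2 * j ^ 2 + 1) ^ d :=
      le_trans (by omega) (Nat.le_self_pow (by omega : d ≠ 0) (2 * j ^ 2 + 1))
    exact_mod_cast this
  have hfin : ∑' j, ∫⁻ ω, ENNReal.ofReal (Z j ω) ∂sampleMeasure d ≠ ⊤ := by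
    have : ∀ j, ∫⁻ ω, ENNReal.ofReal (Z j ω) ∂sampleMeasure d =
        ENNReal.ofReal (∫ ω, Z j ω ∂sampleMeasure d) := fun j =>
      (ofReal_integral_eq_lintegral_ofReal (hZi j) (.of_forall (hZ0 j))).symm
    simp only [this]
    exact hsum.tsum_ofReal_ne_top
  rw [← lintegral_tsum fun j => (hZm j).ennreal_ofReal.aemeasurable] at hfin
  filter_upwards [ae_lt_top (Measurable.tsum fun j => (hZm j).ennreal_ofReal) hfin]
    with ω hω
  have h2 := ENNReal.tendsto_atTop_zero_of_tsum_ne_top hω.ne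
  have h3 : Filter.Tendsto (fun j => Z j ω) Filter.atTop (nhds 0) := by
    have := (ENNReal.tendsto_toReal ENNReal.zero_ne_top).comp h2
    simpa [Function.comp_def, ENNReal.toReal_ofReal (hZ0 _ ω)] using this
  have h4 := h3.sqrt
  simp only [Z, Real.sqrt_sq_eq_abs, Real.sqrt_zero] at h4
  exact tendsto_sub_nhds_zero_iff.1 ((tendsto_zero_iff_abs_tendsto_zero _).2 h4)

/-- The hypothesis `h` bounds the relative difference of the side lengths by `c / (n + 1)`. -/
theorem tendsto_card_box_div {u v : ℕ → ℕ} (d c : ℕ) (huv : ∀ n, u n ≤ v n)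
    (h : ∀ n, 2 * (v n - u n : ℝ) * (n + 1) ≤ c * (2 * v n + 1)) :
    Filter.Tendsto (fun n => ((box d (u n)).card : ℝ) / (box d (v n)).card)
      Filter.atTop (nhds 1) := by
  have h1 : Filter.Tendsto (fun n : ℕ => (2 * u n + 1 : ℝ) / (2 * v n + 1)) Filter.atTop
      (nhds 1) := by
    have h2 : Filter.Tendsto (fun n : ℕ => 1 - c * (1 / ((n : ℝ) + 1))) Filter.atTop (nhds 1) := by
      simpa using (tendsto_one_div_add_atTop_nhds_zero_nat (𝕜 := ℝ)).const_mul (c : ℝ)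
        |>.const_sub 1
    refine tendsto_of_tendsto_of_tendsto_of_le_of_le h2 tendsto_const_nhds (fun n => ?_) fun n => ?_
    · have h3 := h n
      change 1 - c * (1 / ((n : ℝ) + 1)) ≤ (2 * u n + 1 : ℝ) / (2 * v n + 1)
      rw [mul_one_div, one_sub_div (by positivity), div_le_div_iff₀ (by positivity) (by positivity)]
      linarith
    · have h3 : (u n : ℝ) ≤ v n := by exact_mod_cast huv n
      exact div_le_one_of_le₀ (by linarith) (by positivity)
  simpa [card_box, div_pow] using h1.pow d

theorem tendsto_card_box_sq_div (d : ℕ) :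
    Filter.Tendsto (fun j : ℕ => ((box d (j ^ 2)).card : ℝ) / (box d ((j + 1) ^ 2)).card)
      Filter.atTop (nhds 1) :=
  tendsto_card_box_div d 4 (fun n => Nat.pow_le_pow_left n.le_succ 2) fun n => by
    push_cast
    nlinarith [(n.cast_nonneg : (0 : ℝ) ≤ n)]

theorem tendsto_card_box_div_add (d k : ℕ) :
    Filter.Tendsto (fun n : ℕ => ((box d n).card : ℝ) / (box d (n + k)).card)
      Filter.atTop (nhds 1) :=
  tendsto_card_box_div d (2 * k) (fun n => n.le_add_right k) fun n => by
    push_cast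
    nlinarith [(n.cast_nonneg : (0 : ℝ) ≤ n), (k.cast_nonneg : (0 : ℝ) ≤ k),
      mul_nonneg (n.cast_nonneg : (0 : ℝ) ≤ n) (k.cast_nonneg : (0 : ℝ) ≤ k)]

/-- The law of large numbers for local functions. -/
theorem ae_tendsto_boxAverage (hd : 1 ≤ d) (hf : Measurable f)
    (hr : DependsOn f (box d r : Set (Site d))) (h0 : ∀ ω, 0 ≤ f ω) (h1 : ∀ ω, f ω ≤ 1) :
    ∀ᵐ ω ∂sampleMeasure d, Filter.Tendsto (fun n : ℕ => boxAverage f n ω) Filter.atTop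
      (nhds (∫ ω', f ω' ∂sampleMeasure d)) := by
  filter_upwards [ae_tendsto_boxAverage_sq hd hf hr h0 h1] with ω hω
  have hq := tendsto_card_box_sq_div d
  have hsqrt : Filter.Tendsto Nat.sqrt Filter.atTop Filter.atTop :=
    Filter.tendsto_atTop_atTop.2 fun b => ⟨b ^ 2, fun n hn => Nat.le_sqrt'.2 hn⟩
  -- With `s = √n` rounded down, `s² ≤ n ≤ (s+1)²`. Since `f ≥ 0`, the average over `Λ_n` lies
  -- between the sum over `Λ_{s²}` divided by `|Λ_{(s+1)²}|` and the sum over `Λ_{(s+1)²}` divided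
  -- by `|Λ_{s²}|`.
  have hlow := (hω.mul hq).comp hsqrt
  have hupp := ((hω.comp (Filter.tendsto_add_atTop_nat 1)).div hq one_ne_zero).comp hsqrt
  rw [mul_one] at hlow
  rw [div_one] at hupp
  have hmono : Monotone fun n => ∑ x ∈ box d n, f (shift x ω) := fun m n h =>
    Finset.sum_le_sum_of_subset_of_nonneg (box_mono d h) fun x _ _ => h0 _
  have hcard : ∀ {m n : ℕ}, m ≤ n → ((box d m).card : ℝ) ≤ (box d n).card := fun h =>
    by exact_mod_cast Finset.card_le_card (box_mono d h)
  have hs0 : ∀ n, 0 ≤ ∑ x ∈ box d n, f (shift x ω) := fun n => Finset.sum_nonneg fun x _ => h0 _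
  refine tendsto_of_tendsto_of_tendsto_of_le_of_le hlow hupp (fun n => ?_) fun n => ?_
  · have hn : n.sqrt ^ 2 ≤ n := Nat.sqrt_le' n
    have hn' : n ≤ (n.sqrt + 1) ^ 2 := (Nat.lt_succ_sqrt' n).le
    have hp := card_box_pos d (n.sqrt ^ 2)
    have hp' := card_box_pos d n
    simp only [Function.comp_apply, boxAverage]
    rw [div_mul_div_cancel₀ hp.ne']
    exact div_le_div₀ (hs0 _) (hmono hn) hp' (hcard hn')
  · have hn : n.sqrt ^ 2 ≤ n := Nat.sqrt_le' n
    have hn' : n ≤ (n.sqrt + 1) ^ 2 := (Nat.lt_succ_sqrt' n).le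
    have hp := card_box_pos d (n.sqrt ^ 2)
    have hp' := card_box_pos d ((n.sqrt + 1) ^ 2)
    simp only [Function.comp_apply, boxAverage, Pi.div_apply]
    rw [div_div_div_cancel_right₀ hp'.ne']
    exact div_le_div₀ (hs0 _) (hmono hn') hp (hcard hn)

end LocalFunction

/-! ### Local approximation of the spins and of the occupation density. -/

theorem spin_nonneg (b : Bool) : 0 ≤ spin b := by
  unfold spin
  split_ifs <;> norm_num

theorem spin_le_one (b : Bool) : spin b ≤ 1 := by
  unfold spin
  split_ifs <;> norm_num

open scoped Classical in
/-- The indicator of the event that a descent of `m` steps starts at the origin. -/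
noncomputable def descentIndicator (ν m : ℕ) (ω : Sample d) : ℝ :=
  if HasDescent ν m ω then 1 else 0

open scoped Classical in
/-- The local approximation of the spin of the thermodynamic jamming limit at the origin, set to
`0` where a descent of `m` steps starts at the origin. -/
noncomputable def localSpin (S : Set (box d ν → Bool)) (m : ℕ) (ω : Sample d) : ℝ :=
  if HasDescent ν m ω then 0 else spin (jammingLimit S (box d (m * ν)) ω 0)

theorem descentIndicator_nonneg (m : ℕ) (ω : Sample d) : 0 ≤ descentIndicator ν m ω := by
  unfold descentIndicator
  split_ifs <;> norm_num

theorem descentIndicator_le_one (m : ℕ) (ω : Sample d) : descentIndicator ν m ω ≤ 1 := by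
  unfold descentIndicator
  split_ifs <;> norm_num

theorem measurable_descentIndicator (ν m : ℕ) :
    Measurable (descentIndicator ν m : Sample d → ℝ) :=
  .ite (measurableSet_hasDescent ν m) measurable_const measurable_const

theorem dependsOn_descentIndicator (ν m : ℕ) :
    DependsOn (descentIndicator ν m) (box d (m * ν) : Set (Site d)) := fun ω ω' h => by
  have h' := iff_of_eq (dependsOn_hasDescent ν m h)
  classical exact if_congr h' rfl rfl

theorem integral_descentIndicator (ν m : ℕ) :
    ∫ ω, descentIndicator ν m ω ∂sampleMeasure d =
      (sampleMeasure d).real {ω | HasDescent ν m ω} := by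
  rw [← integral_indicator_one (measurableSet_hasDescent ν m)]
  refine integral_congr_ae (.of_forall fun ω => ?_)
  by_cases h : HasDescent ν m ω <;> simp [descentIndicator, h]

section LocalSpin

variable (S : Set (box d ν → Bool))

theorem localSpin_nonneg (m : ℕ) (ω : Sample d) : 0 ≤ localSpin S m ω := by
  unfold localSpin
  split_ifs
  exacts [le_rfl, spin_nonneg _]

theorem localSpin_le_one (m : ℕ) (ω : Sample d) : localSpin S m ω ≤ 1 := by
  unfold localSpin
  split_ifs
  exacts [zero_le_one, spin_le_one _]

theorem measurable_localSpin (m : ℕ) : Measurable (localSpin S m) :=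
  .ite (measurableSet_hasDescent ν m) measurable_const
    ((measurable_of_finite spin).comp (measurable_jammingLimit_apply S _ 0))

theorem dependsOn_localSpin (m : ℕ) :
    DependsOn (localSpin S m) (box d (m * ν) : Set (Site d)) := fun ω ω' h => by
  have h' := iff_of_eq (dependsOn_hasDescent ν m h)
  classical exact if_congr h' rfl (by rw [dependsOn_jammingLimit S _ h])

theorem abs_spin_sub_localSpin_le_one (m : ℕ) (ω : Sample d) (b : Bool) :
    |spin b - localSpin S m ω| ≤ 1 := by
  rw [abs_le]
  constructor <;> linarith [spin_nonneg b, spin_le_one b, localSpin_nonneg S m ω,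
    localSpin_le_one S m ω]

theorem abs_thermoLimit_sub_localSpin_le {ω : Sample d} (hω : Function.Injective ω) (m : ℕ) :
    |spin (thermoLimit S ω 0) - localSpin S m ω| ≤ descentIndicator ν m ω := by
  by_cases hm : HasDescent ν m ω
  · rw [descentIndicator, if_pos hm]
    exact abs_spin_sub_localSpin_le_one S m ω _
  · simp [descentIndicator, localSpin, hm, thermoLimit_zero_eq S hω hm]

theorem abs_jammingLimit_sub_localSpin_le {ω : Sample d} (hω : Function.Injective ω) (m : ℕ)
    {n : ℕ} {x : Site d} (hx : x ∈ box d n) :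
    |spin (jammingLimit S (box d (n + m * ν)) ω x) - localSpin S m (shift x ω)| ≤
      descentIndicator ν m (shift x ω) := by
  by_cases hm : HasDescent ν m (shift x ω)
  · rw [descentIndicator, if_pos hm]
    exact abs_spin_sub_localSpin_le_one S m _ _
  · simp [descentIndicator, localSpin, hm, jammingLimit_box_eq S hω hx hm]

/-- The occupation density is close to the spatial average of the local approximation; the last
terms account for the sites near the boundary. -/
theorem abs_occupationDensity_sub_le {ω : Sample d} (hω : Function.Injective ω) (m n : ℕ) :
    |occupationDensity S (n + m * ν) ω - boxAverage (localSpin S m) (n + m * ν) ω| ≤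
      boxAverage (descentIndicator ν m) (n + m * ν) ω +
        (1 - ((box d n).card : ℝ) / (box d (n + m * ν)).card) := by
  classical
  have hp := card_box_pos d (n + m * ν)
  have hsub := box_mono d (n.le_add_right (m * ν))
  rw [occupationDensity, boxAverage, boxAverage, ← sub_div, ← Finset.sum_sub_distrib, abs_div,
    abs_of_pos hp, one_sub_div hp.ne', ← add_div]
  refine div_le_div_of_nonneg_right ((Finset.abs_sum_le_sum_abs _ _).trans ?_) hp.le
  -- In the inner box the error is at most the descent indicator; in the boundary layer it is
  -- bounded by 1.
  have hpt : ∀ x ∈ box d (n + m * ν),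
      |spin (jammingLimit S (box d (n + m * ν)) ω x) - localSpin S m (shift x ω)| ≤
        descentIndicator ν m (shift x ω) + if x ∈ box d n then 0 else 1 := by
    intro x _
    split_ifs with hx
    · simpa using abs_jammingLimit_sub_localSpin_le S hω m hx
    · exact (abs_spin_sub_localSpin_le_one S m _ _).trans
        (le_add_of_nonneg_left (descentIndicator_nonneg m _))
  refine (Finset.sum_le_sum hpt).trans ?_
  rw [Finset.sum_add_distrib]
  gcongr
  have h : ∀ x, (if x ∈ box d n then (0 : ℝ) else 1) = 1 - if x ∈ box d n then 1 else 0 := by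
    intro x
    split_ifs <;> norm_num
  simp only [h]
  rw [Finset.sum_sub_distrib, Finset.sum_boole, Finset.filter_mem_eq_inter,
    Finset.inter_eq_right.2 hsub]
  simp

theorem integrable_spin_thermoLimit :
    Integrable (fun ω : Sample d => spin (thermoLimit S ω 0)) (sampleMeasure d) :=
  .of_bound
    ((measurable_of_finite spin).comp (measurable_thermoLimit_apply S 0)).aestronglyMeasurable
    1 (.of_forall fun ω => by rw [Real.norm_of_nonneg (spin_nonneg _)]; exact spin_le_one _)

theorem abs_integral_localSpin_sub_le (m : ℕ) :
    |(∫ ω, localSpin S m ω ∂sampleMeasure d) - ∫ ω, spin (thermoLimit S ω 0) ∂sampleMeasure d| ≤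
      ∫ ω, descentIndicator ν m ω ∂sampleMeasure d := by
  have hF : Integrable (localSpin S m) (sampleMeasure d) :=
    .of_bound (measurable_localSpin S m).aestronglyMeasurable 1 (.of_forall fun ω => by
      rw [Real.norm_of_nonneg (localSpin_nonneg S m ω)]; exact localSpin_le_one S m ω)
  have hG : Integrable (descentIndicator ν m) (sampleMeasure d) :=
    .of_bound (measurable_descentIndicator ν m).aestronglyMeasurable 1 (.of_forall fun ω => by
      rw [Real.norm_of_nonneg (descentIndicator_nonneg m ω)]; exact descentIndicator_le_one m ω)
  rw [abs_sub_comm, ← integral_sub (integrable_spin_thermoLimit S) hF]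
  refine (abs_integral_le_integral_abs).trans (integral_mono_ae
    ((integrable_spin_thermoLimit S).sub hF).abs hG ?_)
  filter_upwards [ae_injective] with ω hω
  exact abs_thermoLimit_sub_localSpin_le S hω m

end LocalSpin

end Parking

theorem theorem4p2 (d ν : ℕ) (hd : 1 ≤ d) (hν : 1 ≤ ν)
    (S : Set (Parking.box d ν → Bool)) (hS : Parking.IsParkingScheme S) :
    MeasureTheory.Integrable
        (fun ω : Parking.Sample d => Parking.spin (Parking.thermoLimit S ω 0))
        (Parking.sampleMeasure d) ∧
      ∀ᵐ ω ∂(Parking.sampleMeasure d),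
        Filter.Tendsto (fun n : ℕ => Parking.occupationDensity S n ω) Filter.atTop
          (nhds (∫ ω', Parking.spin (Parking.thermoLimit S ω' 0) ∂(Parking.sampleMeasure d))) := by
  open Parking in
  refine ⟨integrable_spin_thermoLimit S, ?_⟩
  -- A single null set serves all `m`, since `m` will depend on `ε`.
  have hF : ∀ᵐ ω ∂sampleMeasure d, ∀ m, Filter.Tendsto (fun n => boxAverage (localSpin S m) n ω)
      Filter.atTop (nhds (∫ ω', localSpin S m ω' ∂sampleMeasure d)) :=
    ae_all_iff.2 fun m => ae_tendsto_boxAverage hd (measurable_localSpin S m)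
      (dependsOn_localSpin S m) (localSpin_nonneg S m) (localSpin_le_one S m)
  have hG : ∀ᵐ ω ∂sampleMeasure d, ∀ m, Filter.Tendsto
      (fun n => boxAverage (descentIndicator ν m) n ω)
      Filter.atTop (nhds (∫ ω', descentIndicator ν m ω' ∂sampleMeasure d)) :=
    ae_all_iff.2 fun m => ae_tendsto_boxAverage hd (measurable_descentIndicator ν m)
      (dependsOn_descentIndicator ν m) (descentIndicator_nonneg m) (descentIndicator_le_one m)
  filter_upwards [hF, hG, ae_injective] with ω hF hG hω
  rw [Metric.tendsto_atTop']
  intro ε hε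
  -- The descent probability enters twice: as the limit of the bound `hbound`, which is then
  -- eventually below `ε / 2`, and as the bias `hlim`, below `ε / 4`. The total stays below `ε`.
  obtain ⟨m, hm⟩ := ((tendsto_measureReal_hasDescent d ν).eventually
    (gt_mem_nhds (show (0 : ℝ) < ε / 4 by positivity))).exists
  rw [← integral_descentIndicator] at hm
  have hlim := abs_integral_localSpin_sub_le S m
  have hbound : Filter.Tendsto (fun n =>
      |boxAverage (localSpin S m) (n + m * ν) ω - ∫ ω', localSpin S m ω' ∂sampleMeasure d| +
      (boxAverage (descentIndicator ν m) (n + m * ν) ω +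
        (1 - ((box d n).card : ℝ) / (box d (n + m * ν)).card))) Filter.atTop
      (nhds (∫ ω', descentIndicator ν m ω' ∂sampleMeasure d)) := by
    have h1 := ((hF m).comp (Filter.tendsto_add_atTop_nat (m * ν))).sub_const
      (∫ ω', localSpin S m ω' ∂sampleMeasure d) |>.abs
    have h2 := (hG m).comp (Filter.tendsto_add_atTop_nat (m * ν))
    have h3 := (tendsto_card_box_div_add d (m * ν)).const_sub 1
    simpa using h1.add (h2.add h3)
  obtain ⟨N, hN⟩ := Filter.eventually_atTop.1
    (hbound.eventually (gt_mem_nhds (show _ < ε / 2 by linarith)))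
  refine ⟨N + m * ν, fun n hn => ?_⟩
  obtain ⟨k, rfl⟩ : ∃ k, n = k + m * ν := ⟨n - m * ν, by omega⟩
  have h1 := hN k (by omega)
  have h2 := abs_occupationDensity_sub_le S hω m k
  have h3 := abs_sub_le (occupationDensity S (k + m * ν) ω)
    (boxAverage (localSpin S m) (k + m * ν) ω)
    (∫ ω', spin (thermoLimit S ω' 0) ∂sampleMeasure d)
  have h4 := abs_sub_le (boxAverage (localSpin S m) (k + m * ν) ω)
    (∫ ω', localSpin S m ω' ∂sampleMeasure d)
    (∫ ω', spin (thermoLimit S ω' 0) ∂sampleMeasure d)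
  rw [Real.dist_eq]
  linarith
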